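/- For real $\nu$ let $J_\nu(x)=\sum_{k\ge 0}\frac{(-1)^k}{k!\,\Gamma(\nu+k+1)}\left(\frac x2\right)^{2k+\nu}$ $(x>0)$ be the Bessel function of the first kind, and for an integer $n\ge 0$ and $\nu>0$ let $R_{n,\nu}(x)=\sum_{k=0}^{\lfloor n/2\rfloor}(-1)^k\binom{n-k}{k}\frac{\Gamma(\nu+n-k)}{\Gamma(\nu+k)}\left(\frac x2\right)^{2k-n}$ be the Lommel polynomial (a polynomial in $1/x$). Let $\nu>-1$, let $m\ge 1$ be an integer, and let $\mathcal N_{m,\nu}$ be the set of positive zeros of $J_\nu$ that are also zeros of $J_{\nu+m}$. Then the positive zeros of $J_\nu$ that do not lie in $\mathcal N_{m,\nu}$ form an infinite increasing sequence $j_{\nu,k_1}<j_{\nu,k_2}<\cdots$; the set of all positive zeros of $J_{\nu+m}$ together with all positive zeros of $R_{m-1,\nu+1}$ (a set union, so that a zero common to both is listed only once) forms an infinite increasing sequence $\omega_{m,\nu,1}<\omega_{m,\nu,2}<\cdots$; and $$0<j_{\nu,k_1}<\omega_{m,\nu,1}<j_{\nu,k_2}<\omega_{m,\nu,2}<\cdots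 .$$ -/

import Mathlib

/-- The Bessel function of the first kind `J_ν(x)` of real order `ν`, by its power series. It is
meant for `x > 0`, where the real power `(x / 2) ^ (2k + ν)` is the usual one. -/
noncomputable def besselJ (ν x : ℝ) : ℝ :=
  ∑' k : ℕ, (-1 : ℝ) ^ k / ((k.factorial : ℝ) * Real.Gamma (ν + k + 1)) *
    (x / 2) ^ (2 * (k : ℝ) + ν)

/-- The Lommel polynomial `R_{n,ν}(x)`, a polynomial in `1 / x`. For `ν > 0` every Gamma factor
below has a positive argument. -/
noncomputable def lommelR (n : ℕ) (ν x : ℝ) : ℝ :=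
  ∑ k ∈ Finset.range (n / 2 + 1),
    (-1 : ℝ) ^ k * ((n - k).choose k : ℝ) *
      (Real.Gamma (ν + n - k) / Real.Gamma (ν + k)) * (x / 2) ^ (2 * (k : ℤ) - (n : ℤ))

/-- The set of positive zeros of a real function. -/
def posZeros (f : ℝ → ℝ) : Set ℝ := {x | 0 < x ∧ f x = 0}

/-- The set `N_{m,ν}` of the positive zeros of `J_ν` that are also zeros of `J_{ν+m}`. -/
def commonZeros (m : ℕ) (ν : ℝ) : Set ℝ :=
  {x | x ∈ posZeros (besselJ ν) ∧ besselJ (ν + m) x = 0}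

/-- `a 0 < a 1 < a 2 < ⋯` lists all the elements of `S`, each of them once, in ascending order
(in particular `S` is infinite). -/
def IsAscendingList (S : Set ℝ) (a : ℕ → ℝ) : Prop := StrictMono a ∧ Set.range a = S

/-! Put n = m - 1 and F = J_{ν+m} R_{n,ν+1} / J_ν. The recurrence J_ν = R_{n+1,ν+1} J_{ν+m} -
R_{n,ν+1} J_{ν+m+1} (`besselE_eq_lommelQ`) gives 1/F = R_{n+1,ν+1}/R_{n,ν+1} - J_{ν+m+1}/J_{ν+m}.
The first quotient decreases (`lommelQ_wronskian_pos`) and the second increases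
(`besselE_wronskian_pos`), so F increases wherever it is regular.

At a zero of J_ν the factors J_{ν+m} and R_{n,ν+1} vanish together or not at all. Hence the poles of
F are the zeros of J_ν outside N_{m,ν}; at a point of N_{m,ν} a double zero stands over a simple
one, and F has a simple zero there. Between consecutive poles F climbs from -∞ to +∞ and vanishes
exactly once; since F(0) = 0, it has no positive zero before the first pole
(`exists_interlacing_zeros`).

There are infinitely many poles: J_ν oscillates by Sturm comparison, and only finitely many of its
zeros are zeros of the Lommel polynomial. Powers of x / 2 are split off throughout, leaving
functions of s = x ^ 2 / 4 that are smooth at 0. -/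

/-! ### Bessel functions in the variable s = x ^ 2 / 4 -/

/-- The entire function `E_ν` with `J_ν(x) = (x / 2) ^ ν * E_ν(x ^ 2 / 4)`. -/
noncomputable def besselE (ν s : ℝ) : ℝ :=
  ∑' k : ℕ, (-1 : ℝ) ^ k / ((k.factorial : ℝ) * Real.Gamma (ν + k + 1)) * s ^ k

theorem besselJ_eq_rpow_mul_besselE (ν : ℝ) {x : ℝ} (hx : 0 < x) :
    besselJ ν x = (x / 2) ^ ν * besselE ν (x ^ 2 / 4) := by
  rw [besselJ, besselE, ← tsum_mul_left]
  refine tsum_congr fun k => ?_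
  have h2 : (0 : ℝ) < x / 2 := by positivity
  rw [Real.rpow_add h2, Real.rpow_mul h2.le, Real.rpow_natCast, Real.rpow_ofNat]
  have : (x / 2) ^ 2 = x ^ 2 / 4 := by ring
  rw [this]
  ring

theorem besselJ_eq_zero_iff (ν : ℝ) {x : ℝ} (hx : 0 < x) :
    besselJ ν x = 0 ↔ besselE ν (x ^ 2 / 4) = 0 := by
  rw [besselJ_eq_rpow_mul_besselE ν hx, mul_eq_zero, or_iff_right]
  exact (Real.rpow_pos_of_pos (by positivity) ν).ne'

/-- Lets the exponential series dominate. From k = 1 on the values decrease, as the factor ν + k + 1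
in the functional equation is at least 1; k = 0 is bounded apart because ν + 1 may be below 1. -/
theorem exists_inv_Gamma_add_nat_le {ν : ℝ} (hν : -1 < ν) :
    ∃ M : ℝ, ∀ k : ℕ, (Real.Gamma (ν + k + 1))⁻¹ ≤ M := by
  have h0 : 0 < (Real.Gamma (ν + 1))⁻¹ := inv_pos.2 (Real.Gamma_pos_of_pos (by linarith))
  have h1 : 0 < (Real.Gamma (ν + 2))⁻¹ := inv_pos.2 (Real.Gamma_pos_of_pos (by linarith))
  refine ⟨(Real.Gamma (ν + 1))⁻¹ + (Real.Gamma (ν + 2))⁻¹, fun k => ?_⟩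
  rcases k with _ | k
  · simpa using h1.le
  · suffices h : (Real.Gamma (ν + (k + 1 : ℕ) + 1))⁻¹ ≤ (Real.Gamma (ν + 2))⁻¹ by linarith
    induction k with
    | zero => norm_num [add_assoc]
    | succ k ih =>
      refine le_trans ?_ ih
      have hk : (0 : ℝ) ≤ k := k.cast_nonneg
      have hpos : 0 < ν + (k + 1 : ℕ) + 1 := by push_cast; linarith
      have e : ν + ((k + 1 + 1 : ℕ) : ℝ) + 1 = (ν + (k + 1 : ℕ) + 1) + 1 := by push_cast; ring
      rw [e, Real.Gamma_add_one hpos.ne']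
      refine inv_anti₀ (Real.Gamma_pos_of_pos hpos) ?_
      refine le_mul_of_one_le_left (Real.Gamma_pos_of_pos hpos).le ?_
      push_cast; linarith

theorem Gamma_add_nat_add_one_pos {ν : ℝ} (hν : -1 < ν) (k : ℕ) :
    0 < Real.Gamma (ν + k + 1) := by
  have hk : (0 : ℝ) ≤ k := k.cast_nonneg
  exact Real.Gamma_pos_of_pos (by linarith)

theorem abs_besselE_coeff_le {ν M : ℝ} (hν : -1 < ν) {k : ℕ}
    (hM : (Real.Gamma (ν + k + 1))⁻¹ ≤ M) :
    |(-1 : ℝ) ^ k / ((k.factorial : ℝ) * Real.Gamma (ν + k + 1))| ≤ M / k.factorial := by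
  have h := Gamma_add_nat_add_one_pos hν k
  have hk : (0 : ℝ) < k.factorial := by positivity
  rw [abs_div, abs_pow, abs_neg, abs_one, one_pow, abs_of_pos (mul_pos hk h), one_div, mul_inv,
    div_eq_inv_mul]
  exact mul_le_mul_of_nonneg_left hM (by positivity)

theorem summable_besselE {ν : ℝ} (hν : -1 < ν) (s : ℝ) :
    Summable fun k : ℕ =>
      (-1 : ℝ) ^ k / ((k.factorial : ℝ) * Real.Gamma (ν + k + 1)) * s ^ k := by
  obtain ⟨M, hM⟩ := exists_inv_Gamma_add_nat_le hν
  refine Summable.of_norm_bounded ((Real.summable_pow_div_factorial |s|).mul_left M) fun k => ?_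
  rw [Real.norm_eq_abs, abs_mul, abs_pow]
  calc _ ≤ M / k.factorial * |s| ^ k :=
        mul_le_mul_of_nonneg_right (abs_besselE_coeff_le hν (hM k)) (by positivity)
    _ = _ := by ring

theorem hasDerivAt_besselE {ν : ℝ} (hν : -1 < ν) (s : ℝ) :
    HasDerivAt (besselE ν) (-besselE (ν + 1) s) s := by
  obtain ⟨M, hM⟩ := exists_inv_Gamma_add_nat_le hν
  set c : ℕ → ℝ := fun k => (-1 : ℝ) ^ k / ((k.factorial : ℝ) * Real.Gamma (ν + k + 1)) with hc
  set r : ℝ := |s| + 1 with hr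
  have hr0 : 0 < r := by positivity
  have hM0 : 0 ≤ M := (inv_pos.2 (Gamma_add_nat_add_one_pos hν 0)).le.trans (hM 0)
  have hu : Summable fun k : ℕ => M / k.factorial * (k * r ^ (k - 1)) := by
    rw [← summable_nat_add_iff 1]
    refine ((Real.summable_pow_div_factorial r).mul_left M).congr fun k => ?_
    rw [Nat.factorial_succ, Nat.add_sub_cancel]
    push_cast
    field_simp
  have key := hasDerivAt_tsum_of_isPreconnected (g := fun k y => c k * y ^ k)
    (g' := fun k y => c k * (k * y ^ (k - 1))) (t := Metric.ball (0 : ℝ) r) (y₀ := s) (y := s) hu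
    Metric.isOpen_ball (convex_ball 0 r).isPreconnected
    (fun k y _ => (hasDerivAt_pow k y).const_mul (c k))
    (fun k y hy => by
      have hy' : |y| ≤ r := by simpa using (mem_ball_zero_iff.1 hy).le
      rw [norm_mul]
      refine mul_le_mul (abs_besselE_coeff_le hν (hM k)) ?_ (norm_nonneg _) (by positivity)
      rw [norm_mul, norm_pow, Real.norm_natCast, Real.norm_eq_abs]
      gcongr)
    (by simp [hr]) (summable_besselE hν s) (by simp [hr])
  have hsum : Summable fun k : ℕ => c k * (k * s ^ (k - 1)) := by
    refine Summable.of_norm_bounded hu fun k => ?_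
    rw [norm_mul]
    refine mul_le_mul (abs_besselE_coeff_le hν (hM k)) ?_ (norm_nonneg _) (by positivity)
    rw [norm_mul, norm_pow, Real.norm_natCast, Real.norm_eq_abs]
    gcongr
    simp [hr]
  have e : ∑' k : ℕ, c k * (k * s ^ (k - 1)) = -besselE (ν + 1) s := by
    rw [hsum.tsum_eq_zero_add, besselE, ← tsum_neg]
    simp only [Nat.cast_zero, zero_mul, mul_zero, zero_add]
    refine tsum_congr fun k => ?_
    have hg := Gamma_add_nat_add_one_pos hν (k + 1)
    have e1 : ν + 1 + (k : ℝ) + 1 = ν + ((k + 1 : ℕ) : ℝ) + 1 := by push_cast; ring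
    simp only [hc]
    rw [e1, Nat.factorial_succ, Nat.add_sub_cancel]
    have := hg.ne'
    push_cast at this ⊢
    field_simp
    ring
  rw [← e]
  exact key

theorem continuous_besselE {ν : ℝ} (hν : -1 < ν) : Continuous (besselE ν) :=
  continuous_iff_continuousAt.2 fun s => (hasDerivAt_besselE hν s).continuousAt

theorem besselE_recurrence {ν : ℝ} (hν : -1 < ν) (s : ℝ) :
    besselE ν s = (ν + 1) * besselE (ν + 1) s - s * besselE (ν + 2) s := by
  have h0 := summable_besselE hν s
  have h1 := summable_besselE (ν := ν + 1) (by linarith) s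
  have h2 := summable_besselE (ν := ν + 2) (by linarith) s
  have e : s * besselE (ν + 2) s = (ν + 1) * besselE (ν + 1) s - besselE ν s := by
    simp only [besselE]
    rw [← tsum_mul_left, ← tsum_mul_left, ← (h1.mul_left _).tsum_sub h0,
      ((h1.mul_left (ν + 1)).sub h0).tsum_eq_zero_add]
    have g0 : Real.Gamma (ν + 1 + 1) = (ν + 1) * Real.Gamma (ν + 1) :=
      Real.Gamma_add_one (by linarith)
    have hp : 0 < Real.Gamma (ν + 1) := Real.Gamma_pos_of_pos (by linarith)
    have hz : (ν + 1) ≠ 0 := by linarith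
    have z : (ν + 1) * ((-1 : ℝ) ^ 0 / (((0).factorial : ℝ) * Real.Gamma (ν + 1 + (0 : ℕ) + 1)) *
        s ^ 0) - (-1 : ℝ) ^ 0 / (((0).factorial : ℝ) * Real.Gamma (ν + (0 : ℕ) + 1)) * s ^ 0
        = 0 := by
      simp only [Nat.cast_zero, add_zero, g0]
      have := hp.ne'
      field_simp
      simp
    rw [z, zero_add]
    refine tsum_congr fun k => ?_
    have hg := Gamma_add_nat_add_one_pos hν (k + 1)
    have hk : (0 : ℝ) ≤ k := k.cast_nonneg
    have hne : ν + ((k + 1 : ℕ) : ℝ) + 1 ≠ 0 := by push_cast; linarith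
    have e1 : ν + 1 + ((k + 1 : ℕ) : ℝ) + 1 = (ν + ((k + 1 : ℕ) : ℝ) + 1) + 1 := by
      push_cast; ring
    have e2 : ν + 2 + (k : ℝ) + 1 = (ν + ((k + 1 : ℕ) : ℝ) + 1) + 1 := by push_cast; ring
    rw [e1, e2, Real.Gamma_add_one hne, Nat.factorial_succ]
    have := hg.ne'
    push_cast at this hne ⊢
    field_simp
    ring
  linarith

theorem besselE_zero_pos {ν : ℝ} (hν : -1 < ν) : 0 < besselE ν 0 := by
  have h : besselE ν 0 = (Real.Gamma (ν + 1))⁻¹ := by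
    rw [besselE, tsum_eq_single 0]
    · simp
    · intro k hk
      simp [hk]
  rw [h]
  exact inv_pos.2 (Real.Gamma_pos_of_pos (by linarith))

/-! ### A Turán type inequality -/

/-- A Turán type inequality: up to a positive factor, `J_μ J_{μ+1}' - J_μ' J_{μ+1}` is positive. -/
theorem besselE_wronskian_pos {μ s : ℝ} (hμ : -1 < μ) (hs : 0 < s) :
    0 < besselE μ s ^ 2 + s * besselE (μ + 1) s ^ 2
      - (μ + 1 / 2) * (besselE μ s * besselE (μ + 1) s) := by
  set a := besselE μ with ha
  set b := besselE (μ + 1) with hb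
  set T : ℝ → ℝ := fun t => a t ^ 2 + t * b t ^ 2 - (μ + 1 / 2) * (a t * b t) with hT
  have ca : Continuous a := continuous_besselE hμ
  have cb : Continuous b := continuous_besselE (by linarith)
  have cT : Continuous T := by fun_prop
  have hT0 : 0 < T 0 := by
    have h1 := besselE_zero_pos hμ
    have h2 := besselE_zero_pos (ν := μ + 1) (by linarith)
    have h3 := besselE_recurrence hμ 0
    rw [zero_mul, sub_zero] at h3
    have : T 0 = 1 / 2 * (a 0 * b 0) := by
      simp only [hT, ha, hb]
      rw [h3]; ring
    rw [this]; positivity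
  -- With W = J_μ J_{μ+1}' - J_μ' J_{μ+1}, this function is s * W, whose derivative in s is (J_μ ^ 2
  -- + J_{μ+1} ^ 2) / 2.
  have hmono : MonotoneOn (fun t => t ^ (μ + 1) * T t) (Set.Icc 0 s) := by
    refine monotoneOn_of_deriv_nonneg (convex_Icc 0 s) ?_ ?_ ?_
    · exact ((Real.continuous_rpow_const (by linarith)).mul cT).continuousOn
    all_goals
      intro t ht
      rw [interior_Icc] at ht
      have ht0 : 0 < t := ht.1
      have da := hasDerivAt_besselE hμ t
      have db := hasDerivAt_besselE (ν := μ + 1) (by linarith) t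
      rw [← ha, ← hb] at da
      rw [← hb, show μ + 1 + 1 = μ + 2 by ring] at db
      have dT := ((da.pow 2).add ((hasDerivAt_id t).mul (db.pow 2))).sub
        ((da.mul db).const_mul (μ + 1 / 2))
      have dh := (Real.hasDerivAt_rpow_const (x := t) (p := μ + 1) (Or.inl ht0.ne')).mul dT
      have hd : HasDerivAt (fun t => t ^ (μ + 1) * T t)
          (t ^ μ * (1 / 2 * (a t ^ 2 + t * b t ^ 2))) t := by
        refine dh.congr_deriv ?_
        have r := besselE_recurrence hμ t
        rw [← ha, ← hb] at r
        have e : t ^ (μ + 1) = t ^ μ * t := by rw [Real.rpow_add ht0, Real.rpow_one]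
        simp only [id, Pi.add_apply, Pi.mul_apply, Pi.sub_apply, Pi.pow_apply]
        rw [e, show μ + 1 - 1 = μ by ring]
        have hd : t * besselE (μ + 2) t = (μ + 1) * b t - a t := by linarith
        linear_combination (t ^ μ * (-2 * t * b t + (μ + 1 / 2) * a t)) * hd
    · exact hd.differentiableAt.differentiableWithinAt
    · rw [hd.deriv]
      have := Real.rpow_nonneg ht0.le μ
      positivity
  -- The monotone function vanishes at 0, so comparison with 0 would only give `0 ≤ T s`; strictness
  -- comes from a nearby δ > 0.
  obtain ⟨δ, hδ, hδT⟩ : ∃ δ ∈ Set.Ioc 0 s, 0 < T δ := by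
    have h1 : ∀ᶠ t in nhdsWithin (0 : ℝ) (Set.Ioi 0), 0 < T t :=
      (cT.continuousAt.eventually (lt_mem_nhds hT0)).filter_mono nhdsWithin_le_nhds
    have h2 : ∀ᶠ t in nhdsWithin (0 : ℝ) (Set.Ioi 0), t ∈ Set.Ioc 0 s :=
      Ioc_mem_nhdsGT hs
    obtain ⟨δ, h, h'⟩ := (h2.and h1).exists
    exact ⟨δ, h, h'⟩
  have h1 := hmono ⟨hδ.1.le, hδ.2⟩ ⟨hs.le, le_rfl⟩ hδ.2
  have h2 : 0 < δ ^ (μ + 1) * T δ := mul_pos (Real.rpow_pos_of_pos hδ.1 _) hδT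
  exact pos_of_mul_pos_right (h2.trans_le h1) (Real.rpow_nonneg hs.le _)

/-! ### Lommel polynomials -/

open Polynomial in
/-- The polynomials `Q_n` with `R_{n,ν+1}(x) = (x / 2) ^ (-n) * Q_n(x ^ 2 / 4)`. -/
noncomputable def lommelQ (ν : ℝ) : ℕ → Polynomial ℝ
  | 0 => 1
  | 1 => C (ν + 1)
  | n + 2 => C (ν + n + 2) * lommelQ ν (n + 1) - X * lommelQ ν n

theorem eval_lommelQ_add_two (ν s : ℝ) (n : ℕ) :
    (lommelQ ν (n + 2)).eval s =
      (ν + n + 2) * (lommelQ ν (n + 1)).eval s - s * (lommelQ ν n).eval s := by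
  simp [lommelQ]

/-- The coefficient of `s ^ k` in `Q_n`. -/
noncomputable def lommelCoeff (ν : ℝ) (n k : ℕ) : ℝ :=
  (-1 : ℝ) ^ k * ((n - k).choose k : ℝ) *
    (Real.Gamma (ν + 1 + n - k) / Real.Gamma (ν + 1 + k))

theorem lommelCoeff_eq_zero (ν : ℝ) {n k : ℕ} (h : n / 2 < k) : lommelCoeff ν n k = 0 := by
  rw [lommelCoeff, Nat.choose_eq_zero_of_lt (by omega)]
  simp

theorem lommelCoeff_zero_right_add_one {ν : ℝ} (hν : -1 < ν) (n : ℕ) :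
    lommelCoeff ν (n + 1) 0 = (ν + n + 1) * lommelCoeff ν n 0 := by
  have hn : (0 : ℝ) ≤ n := n.cast_nonneg
  have e : ν + 1 + ((n + 1 : ℕ) : ℝ) - (0 : ℕ) = (ν + n + 1) + 1 := by push_cast; ring
  have e' : ν + 1 + (n : ℝ) - (0 : ℕ) = ν + n + 1 := by push_cast; ring
  rw [lommelCoeff, lommelCoeff, e, e', Real.Gamma_add_one (by linarith)]
  simp
  ring

/-- Within the degree range write n = 2k + j. Once the Gamma factors cancel, Pascal's rule and the
absorption identity `c2` remain. -/
theorem lommelCoeff_recurrence {ν : ℝ} (hν : -1 < ν) (n k : ℕ) :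
    lommelCoeff ν (n + 2) (k + 1) =
      (ν + n + 2) * lommelCoeff ν (n + 1) (k + 1) - lommelCoeff ν n k := by
  by_cases hk : n / 2 < k
  · rw [lommelCoeff_eq_zero ν hk, lommelCoeff_eq_zero ν (by omega : (n + 1) / 2 < k + 1),
      lommelCoeff_eq_zero ν (by omega : (n + 2) / 2 < k + 1)]
    ring
  obtain ⟨i, rfl⟩ : ∃ i, n = k + i := ⟨n - k, by omega⟩
  have hki : k ≤ i := by omega
  obtain ⟨j, rfl⟩ : ∃ j, i = k + j := ⟨i - k, by omega⟩
  have hk0 : (0 : ℝ) ≤ k := k.cast_nonneg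
  have hj0 : (0 : ℝ) ≤ j := j.cast_nonneg
  have hp1 : 0 < ν + 1 + k := by linarith
  have hp2 : 0 < ν + 1 + (k + j : ℝ) := by linarith
  have hG1 := (Real.Gamma_pos_of_pos hp1).ne'
  have n1 : k + (k + j) + 2 - (k + 1) = (k + j) + 1 := by omega
  have n2 : k + (k + j) + 1 - (k + 1) = k + j := by omega
  have n3 : k + (k + j) - k = k + j := by omega
  have e1 : ν + 1 + ((k + (k + j) + 2 : ℕ) : ℝ) - ((k + 1 : ℕ) : ℝ)
      = (ν + 1 + (k + j : ℝ)) + 1 := by push_cast; ring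
  have e2 : ν + 1 + ((k + (k + j) + 1 : ℕ) : ℝ) - ((k + 1 : ℕ) : ℝ)
      = ν + 1 + (k + j : ℝ) := by push_cast; ring
  have e3 : ν + 1 + ((k + (k + j) : ℕ) : ℝ) - (k : ℝ) = ν + 1 + (k + j : ℝ) := by
    push_cast; ring
  have e4 : ν + 1 + ((k + 1 : ℕ) : ℝ) = (ν + 1 + k) + 1 := by push_cast; ring
  have c1 : (((k + j + 1).choose (k + 1) : ℕ) : ℝ)
      = ((k + j).choose k : ℝ) + ((k + j).choose (k + 1) : ℝ) := by
    rw [Nat.choose_succ_succ]; push_cast; ring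
  have c2 : ((k + j).choose (k + 1) : ℝ) * (k + 1) = ((k + j).choose k : ℝ) * j := by
    have := Nat.choose_succ_right_eq (k + j) k
    rw [Nat.add_sub_cancel_left] at this
    exact_mod_cast this
  unfold lommelCoeff
  rw [n1, n2, n3, e1, e2, e3, e4, Real.Gamma_add_one hp1.ne', Real.Gamma_add_one hp2.ne', c1,
    pow_succ]
  have := hp1.ne'
  push_cast
  field_simp
  linear_combination c2

/-- The free upper bound K lets sums of different degrees be brought to matching ranges in the
recurrence. -/
theorem eval_lommelQ {ν : ℝ} (hν : -1 < ν) (s : ℝ) :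
    ∀ n K : ℕ, n / 2 < K →
      (lommelQ ν n).eval s = ∑ k ∈ Finset.range K, lommelCoeff ν n k * s ^ k := by
  have ext (n K : ℕ) (h : n / 2 < K) : ∑ k ∈ Finset.range K, lommelCoeff ν n k * s ^ k =
      ∑ k ∈ Finset.range (n / 2 + 1), lommelCoeff ν n k * s ^ k := by
    refine (Finset.sum_subset (Finset.range_subset_range.2 h) fun k _ hk => ?_).symm
    rw [lommelCoeff_eq_zero ν (by simpa using hk), zero_mul]
  suffices h : ∀ n, ∃ K, n / 2 < K ∧
      (lommelQ ν n).eval s = ∑ k ∈ Finset.range K, lommelCoeff ν n k * s ^ k by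
    intro n K hK
    obtain ⟨K', hK', e⟩ := h n
    rw [e, ext n K hK, ext n K' hK']
  have hG : Real.Gamma (ν + 1) ≠ 0 := (Real.Gamma_pos_of_pos (by linarith)).ne'
  have h00 : lommelCoeff ν 0 0 = 1 := by simp [lommelCoeff, hG]
  intro n
  induction n using Nat.twoStepInduction with
  | zero => exact ⟨1, by simp, by simp [lommelQ, h00]⟩
  | one =>
    refine ⟨1, by simp, ?_⟩
    simpa [lommelQ, h00] using (lommelCoeff_zero_right_add_one hν 0).symm
  | more n ih1 ih2 =>
    obtain ⟨K1, hK1, e1⟩ := ih1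
    obtain ⟨K2, hK2, e2⟩ := ih2
    refine ⟨n + 2, by omega, ?_⟩
    rw [eval_lommelQ_add_two, e1, e2, ext n K1 hK1, ext _ K2 hK2, ← ext n (n + 1) (by omega),
      ← ext (n + 1) (n + 2) (by omega),
      Finset.sum_range_succ' _ (n + 1), Finset.sum_range_succ' _ (n + 1), lommelCoeff_zero_right_add_one hν (n + 1), mul_add, Finset.mul_sum, Finset.mul_sum,
      add_sub_right_comm, ← Finset.sum_sub_distrib]
    congr 1
    · refine Finset.sum_congr rfl fun k _ => ?_
      rw [lommelCoeff_recurrence hν]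
      ring
    · push_cast
      ring

theorem lommelR_eq_zpow_mul_eval {ν x : ℝ} (hν : -1 < ν) (hx : 0 < x) (n : ℕ) :
    lommelR n (ν + 1) x = (x / 2) ^ (-(n : ℤ)) * (lommelQ ν n).eval (x ^ 2 / 4) := by
  rw [eval_lommelQ hν _ n (n / 2 + 1) (Nat.lt_succ_self _), lommelR, Finset.mul_sum]
  refine Finset.sum_congr rfl fun k _ => ?_
  have h2 : x / 2 ≠ 0 := by positivity
  rw [lommelCoeff, sub_eq_add_neg (2 * (k : ℤ)), zpow_add₀ h2, zpow_mul, zpow_natCast]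
  have : (x / 2) ^ (2 : ℤ) = x ^ 2 / 4 := by rw [zpow_ofNat]; ring
  rw [this]
  ring

theorem lommelR_eq_zero_iff {ν x : ℝ} (hν : -1 < ν) (hx : 0 < x) (n : ℕ) :
    lommelR n (ν + 1) x = 0 ↔ (lommelQ ν n).eval (x ^ 2 / 4) = 0 := by
  rw [lommelR_eq_zpow_mul_eval hν hx, mul_eq_zero, or_iff_right]
  exact (zpow_pos (by positivity) _).ne'

theorem besselE_eq_lommelQ {ν : ℝ} (hν : -1 < ν) (s : ℝ) (n : ℕ) :
    besselE ν s = (lommelQ ν (n + 1)).eval s * besselE (ν + n + 1) s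
      - s * (lommelQ ν n).eval s * besselE (ν + n + 2) s := by
  induction n with
  | zero =>
    rw [besselE_recurrence hν]
    simp [lommelQ]
  | succ n ih =>
    have hn : (0 : ℝ) ≤ n := n.cast_nonneg
    have r := besselE_recurrence (ν := ν + n + 1) (by linarith) s
    have e1 : ν + n + 1 + 1 = ν + ((n + 1 : ℕ) : ℝ) + 1 := by push_cast; ring
    have e2 : ν + n + 1 + 2 = ν + ((n + 1 : ℕ) : ℝ) + 2 := by push_cast; ring
    have e3 : ν + (n : ℝ) + 2 = ν + ((n + 1 : ℕ) : ℝ) + 1 := by push_cast; ring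
    rw [e1, e2] at r
    rw [e3] at ih
    rw [ih, r, eval_lommelQ_add_two]
    push_cast
    ring

/-- Up to a positive factor, `R_n' R_{n+1} - R_n R_{n+1}'` is positive. -/
theorem lommelQ_wronskian_pos {ν s : ℝ} (hν : -1 < ν) (hs : 0 < s) (n : ℕ) :
    0 < 1 / 2 * (lommelQ ν n).eval s * (lommelQ ν (n + 1)).eval s +
      s * ((lommelQ ν n).derivative.eval s * (lommelQ ν (n + 1)).eval s -
        (lommelQ ν n).eval s * (lommelQ ν (n + 1)).derivative.eval s) := by
  induction n with
  | zero => simp [lommelQ]; linarith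
  | succ n ih =>
    have hn : (0 : ℝ) ≤ n := n.cast_nonneg
    have hd : (lommelQ ν (n + 2)).derivative.eval s =
        (ν + n + 2) * (lommelQ ν (n + 1)).derivative.eval s -
          ((lommelQ ν n).eval s + s * (lommelQ ν n).derivative.eval s) := by
      simp [lommelQ]
    have h2 : 0 ≤ 1 / 2 * (ν + n + 2) * (lommelQ ν (n + 1)).eval s ^ 2 :=
      mul_nonneg (by linarith) (sq_nonneg _)
    have key := add_pos_of_pos_of_nonneg (mul_pos hs ih) h2
    -- Writing W_n for the quantity at n, the recurrence gives W_{n+1} = s W_n + (ν + n + 2) / 2 *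
    -- Q_{n+1} ^ 2.
    refine key.trans_eq ?_
    rw [hd, eval_lommelQ_add_two]
    ring

theorem lommelQ_ne_zero {ν : ℝ} (hν : -1 < ν) (n : ℕ) : lommelQ ν n ≠ 0 := by
  intro h
  have := lommelQ_wronskian_pos hν one_pos n
  simp [h] at this

/-! ### Oscillation of the Bessel function -/

/-- The zeros of `J_ν` are unbounded, by comparison with `sin (x / 2)`. -/
theorem exists_besselE_eq_zero_of_gt {ν : ℝ} (hν : -1 < ν) (M : ℝ) :
    ∃ x, M < x ∧ 0 < x ∧ besselE ν (x ^ 2 / 4) = 0 := by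
  by_contra! hne
  set g : ℝ → ℝ := fun x => besselE ν (x ^ 2 / 4) with hg
  have cg : Continuous g := (continuous_besselE hν).comp (by fun_prop)
  -- Since A ≥ 1, the last bound yields (ν ^ 2 - 1 / 4) / x ^ 2 ≤ 3 / 4 for x ≥ A.
  obtain ⟨A, hA1, hAM, hAν⟩ : ∃ A : ℝ, 1 ≤ A ∧ M < A ∧ 4 / 3 * (ν ^ 2 - 1 / 4) ≤ A :=
    ⟨max (max 1 (M + 1)) (4 / 3 * (ν ^ 2 - 1 / 4)), by simp, by
      refine lt_of_lt_of_le (lt_add_one M) ?_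
      simp, by simp⟩
  obtain ⟨ε, hε, hpos⟩ : ∃ ε : ℝ, ε ≠ 0 ∧ ∀ x, A ≤ x → 0 < ε * g x := by
    have hA : g A ≠ 0 := hne A hAM (by linarith)
    refine ⟨g A, hA, fun x hx => ?_⟩
    by_contra! hcon
    obtain ⟨y, hy, hy0⟩ : (0 : ℝ) ∈ (fun y => g A * g y) '' Set.Icc A x :=
      intermediate_value_Icc' hx (continuous_const.mul cg).continuousOn
        ⟨hcon, mul_self_nonneg (g A)⟩
    have : g y = 0 := (mul_eq_zero.1 hy0).resolve_left hA
    exact hne y (by linarith [hy.1]) (by linarith [hy.1]) this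
  set B : ℝ := A + 2 * Real.pi with hB
  have hAB : A ≤ B := by linarith [Real.pi_pos]
  set α : ℝ := ν + 1 / 2 with hα
  set w : ℝ → ℝ := fun x => Real.sin ((x - A) / 2) with hw
  set v : ℝ → ℝ := fun x => 1 / 2 * Real.cos ((x - A) / 2) with hv
  set h : ℝ → ℝ := fun x => besselE (ν + 1) (x ^ 2 / 4) with hh
  -- D is ε (u' w - u w') with u = x ^ α * g, a multiple of x ^ (1/2) * J_ν. It solves u'' = -(1 -
  -- (ν ^ 2 - 1 / 4) / x ^ 2) u, while w'' = -w / 4, and A, B are consecutive zeros of w. So D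
  -- decreases, yet its endpoint values force D A < 0 < D B.
  set D : ℝ → ℝ := fun x => ε * (x ^ α * ((α / x * g x - x / 2 * h x) * w x - g x * v x)) with hD
  have hderiv : ∀ x, 0 < x → HasDerivAt D
      (-(x ^ α * (3 / 4 - (ν ^ 2 - 1 / 4) / x ^ 2) * (ε * g x) * w x)) x := by
    intro x hx
    have dq : HasDerivAt (fun y : ℝ => y ^ 2 / 4) (x / 2) x := by
      refine ((hasDerivAt_pow 2 x).div_const 4).congr_deriv ?_
      push_cast; ring
    have dg : HasDerivAt g (-besselE (ν + 1) (x ^ 2 / 4) * (x / 2)) x :=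
      (hasDerivAt_besselE hν _).comp x dq
    have dh : HasDerivAt h (-besselE (ν + 2) (x ^ 2 / 4) * (x / 2)) x := by
      have := (hasDerivAt_besselE (ν := ν + 1) (by linarith) (x ^ 2 / 4)).comp x dq
      rwa [show ν + 1 + 1 = ν + 2 by ring] at this
    have dl : HasDerivAt (fun y : ℝ => (y - A) / 2) (1 / 2) x :=
      ((hasDerivAt_id x).sub_const A).div_const 2
    have dw : HasDerivAt w (Real.cos ((x - A) / 2) * (1 / 2)) x := dl.sin
    have dv : HasDerivAt v (1 / 2 * (-Real.sin ((x - A) / 2) * (1 / 2))) x :=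
      dl.cos.const_mul _
    have dr : HasDerivAt (fun y : ℝ => α / y) (-α / x ^ 2) x := by
      refine ((hasDerivAt_inv hx.ne').const_mul α).congr_deriv ?_
      ring
    have dx : HasDerivAt (fun y : ℝ => y / 2) (1 / 2) x := (hasDerivAt_id x).div_const 2
    have dp := Real.hasDerivAt_rpow_const (x := x) (p := α) (Or.inl hx.ne')
    have dD := (dp.mul ((((dr.mul dg).sub (dx.mul dh)).mul dw).sub (dg.mul dv))).const_mul ε
    refine dD.congr_deriv ?_
    have e : x ^ (α - 1) = x ^ α / x := by rw [Real.rpow_sub hx, Real.rpow_one]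
    have r := besselE_recurrence hν (x ^ 2 / 4)
    have r' : besselE (ν + 2) (x ^ 2 / 4) =
        4 / x ^ 2 * ((ν + 1) * besselE (ν + 1) (x ^ 2 / 4) - besselE ν (x ^ 2 / 4)) := by
      rw [r]; field_simp; ring
    simp only [Pi.mul_apply, Pi.sub_apply]
    rw [e, r']
    simp only [hg, hh, hw, hv, hα]
    field_simp
    ring
  have hanti : AntitoneOn D (Set.Icc A B) := by
    refine antitoneOn_of_deriv_nonpos (convex_Icc A B) ?_ ?_ ?_
    · intro x hx
      exact (hderiv x (by linarith [hx.1])).continuousAt.continuousWithinAt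
    all_goals
      intro x hx
      rw [interior_Icc] at hx
      have hx0 : 0 < x := by linarith [hx.1]
    · exact (hderiv x hx0).differentiableAt.differentiableWithinAt
    · rw [(hderiv x hx0).deriv, neg_nonpos]
      have h1 : 0 ≤ w x := Real.sin_nonneg_of_nonneg_of_le_pi (by linarith [hx.1])
        (by linarith [hx.2])
      have h2 : (ν ^ 2 - 1 / 4) / x ^ 2 ≤ 3 / 4 := by
        rw [div_le_iff₀ (by positivity)]
        nlinarith [hx.1]
      have h3 := hpos x hx.1.le
      have h4 := Real.rpow_nonneg hx0.le α
      exact mul_nonneg (mul_nonneg (mul_nonneg h4 (by linarith)) h3.le) h1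
  have hDAB := hanti ⟨le_rfl, hAB⟩ ⟨hAB, le_rfl⟩ hAB
  have hA0 : 0 < A := by linarith
  have hDA : D A = -(1 / 2 * (A ^ α * (ε * g A))) := by
    simp [hD, hw, hv]; ring
  have hDB : D B = 1 / 2 * (B ^ α * (ε * g B)) := by
    have : (B - A) / 2 = Real.pi := by rw [hB]; ring
    simp only [hD, hw, hv, this, Real.sin_pi, Real.cos_pi]
    ring
  have p1 := mul_pos (Real.rpow_pos_of_pos hA0 α) (hpos A le_rfl)
  have p2 := mul_pos (Real.rpow_pos_of_pos (hA0.trans_le hAB) α) (hpos B hAB)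
  linarith

/-! ### Interlacing from a monotone quotient -/

/-- Iterate "least element above", starting from 0. An element never reached would have infinitely
many elements of S below it. -/
theorem exists_isAscendingList {S : Set ℝ} (hS : S.Infinite) (hpos : ∀ x ∈ S, 0 < x)
    (hfin : ∀ M, (S ∩ Set.Iic M).Finite) : ∃ j, IsAscendingList S j := by
  have : Infinite S := hS.to_subtype
  have hunb (M : ℝ) : ∃ x ∈ S, M < x := by
    by_contra! h
    exact hS ((hfin M).subset fun x hx => ⟨hx, h x hx⟩)
  have hleast (M : ℝ) : ∃ x ∈ S, M < x ∧ ∀ y ∈ S, M < y → x ≤ y := by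
    obtain ⟨z, hz, hMz⟩ := hunb M
    obtain ⟨x, hx, hmin⟩ := Set.exists_min_image (S ∩ Set.Ioc M z) id
      ((hfin z).subset fun y hy => ⟨hy.1, hy.2.2⟩) ⟨z, hz, hMz, le_rfl⟩
    refine ⟨x, hx.1, hx.2.1, fun y hy hMy => ?_⟩
    rcases le_total y z with h | h
    · exact hmin y ⟨hy, hMy, h⟩
    · exact hx.2.2.trans h
  choose f hfS hf hfmin using hleast
  let j : ℕ → ℝ := fun k => Nat.rec (f 0) (fun _ y => f y) k
  have hj (k : ℕ) : j (k + 1) = f (j k) := rfl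
  have hjS (k : ℕ) : j k ∈ S := by cases k <;> exact hfS _
  have hmono : StrictMono j := strictMono_nat_of_lt_succ fun k => hf _
  refine ⟨j, hmono, Set.Subset.antisymm (Set.range_subset_iff.2 hjS) fun x hx => ?_⟩
  by_contra hxj
  have hlt (k : ℕ) : j k < x := by
    refine lt_of_le_of_ne ?_ fun h => hxj ⟨k, h⟩
    induction k with
    | zero => exact hfmin 0 x hx (hpos x hx)
    | succ k ih => exact hfmin _ x hx (lt_of_le_of_ne ih fun h => hxj ⟨k, h⟩)
  exact Set.infinite_range_of_injective hmono.injective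
    ((hfin x).subset (Set.range_subset_iff.2 fun k => ⟨hjS k, (hlt k).le⟩))

/-- If `G / E` is continuous and increases away from those positive zeros of `E` that are not zeros
of `G`, then these zeros interlace with the positive zeros of `G`. -/
theorem exists_interlacing_zeros {E G : ℝ → ℝ} (hE : Continuous E) (hG : Continuous G)
    (hE0 : E 0 ≠ 0) (hG0 : G 0 = 0)
    (hF : ∀ x, 0 < x → (E x ≠ 0 ∨ G x = 0) →
      ∃ d, 0 < d ∧ HasDerivAt (fun y => G y / E y) d x)
    (hinf : {x | 0 < x ∧ E x = 0 ∧ G x ≠ 0}.Infinite)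
    (hfin : ∀ M, ({x | 0 < x ∧ E x = 0 ∧ G x ≠ 0} ∩ Set.Iic M).Finite) :
    ∃ j ω : ℕ → ℝ, IsAscendingList {x | 0 < x ∧ E x = 0 ∧ G x ≠ 0} j ∧
      IsAscendingList {x | 0 < x ∧ G x = 0} ω ∧
      0 < j 0 ∧ ∀ k : ℕ, j k < ω k ∧ ω k < j (k + 1) := by
  obtain ⟨j, hj⟩ := exists_isAscendingList hinf (fun x hx => hx.1) hfin
  have hjS (k : ℕ) : 0 < j k ∧ E (j k) = 0 ∧ G (j k) ≠ 0 := hj.2.subset ⟨k, rfl⟩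
  set F : ℝ → ℝ := fun y => G y / E y with hFdef
  have hgap (k : ℕ) {x : ℝ} (hx : x ∈ Set.Ioo (j k) (j (k + 1))) : E x ≠ 0 ∨ G x = 0 := by
    by_contra! h
    obtain ⟨i, rfl⟩ := hj.2.symm.subset ⟨(hjS k).1.trans hx.1, h⟩
    have h1 := hj.1.lt_iff_lt.1 hx.1
    have h2 := hj.1.lt_iff_lt.1 hx.2
    omega
  have hgap0 {x : ℝ} (h0 : 0 < x) (hx : x < j 0) : E x ≠ 0 ∨ G x = 0 := by
    by_contra! h
    obtain ⟨i, rfl⟩ := hj.2.symm.subset ⟨h0, h⟩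
    have := hj.1.lt_iff_lt.1 hx
    omega
  have hcont (k : ℕ) : ContinuousOn F (Set.Ioo (j k) (j (k + 1))) := fun x hx => by
    obtain ⟨d, -, h⟩ := hF x ((hjS k).1.trans hx.1) (hgap k hx)
    exact h.continuousAt.continuousWithinAt
  have hmono (k : ℕ) : StrictMonoOn F (Set.Ioo (j k) (j (k + 1))) := by
    refine strictMonoOn_of_deriv_pos (convex_Ioo _ _) (hcont k) fun x hx => ?_
    rw [interior_Ioo] at hx
    obtain ⟨d, hd, h⟩ := hF x ((hjS k).1.trans hx.1) (hgap k hx)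
    rwa [h.deriv]
  have hmono0 : StrictMonoOn F (Set.Ico 0 (j 0)) := by
    refine strictMonoOn_of_deriv_pos (convex_Ico _ _) (fun x hx => ?_) fun x hx => ?_
    · rcases hx.1.eq_or_lt with rfl | h0
      · exact (hG.continuousAt.div hE.continuousAt hE0).continuousWithinAt
      · obtain ⟨d, -, h⟩ := hF x h0 (hgap0 h0 hx.2)
        exact h.continuousAt.continuousWithinAt
    · rw [interior_Ico] at hx
      obtain ⟨d, hd, h⟩ := hF x hx.1 (hgap0 hx.1 hx.2)
      rwa [h.deriv]
  -- This includes removable points: there E and G both vanish.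
  have hGF (k : ℕ) {x : ℝ} (hx : x ∈ Set.Ioo (j k) (j (k + 1))) : G x = F x * E x := by
    rcases eq_or_ne (E x) 0 with h | h
    · rw [(hgap k hx).resolve_left (not_not.2 h), h, mul_zero]
    · rw [hFdef]; field_simp
  have hF0 (k : ℕ) {x : ℝ} (hx : x ∈ Set.Ioo (j k) (j (k + 1))) : F x = 0 ↔ G x = 0 :=
    ⟨fun h => by rw [hGF k hx, h, zero_mul], fun h => by simp [hFdef, h]⟩
  -- F is unbounded near each pole: |F| ≤ C gives |G| ≤ C |E|, hence G c = 0 in the limit. With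
  -- monotonicity, F must therefore take both signs on the gap.
  have hend (k : ℕ) (c C : ℝ) (hc : c = j k ∨ c = j (k + 1)) (l : Filter ℝ) [l.NeBot]
      (hl : l ≤ nhds c) (h : ∀ᶠ x in l, x ∈ Set.Ioo (j k) (j (k + 1)) ∧ |F x| ≤ C) : False := by
    have hEG : E c = 0 ∧ G c ≠ 0 := by rcases hc with rfl | rfl <;> exact (hjS _).2
    have h1 : Filter.Tendsto (fun x => |G x|) l (nhds |G c|) :=
      (hG.abs.tendsto c).mono_left hl
    have h2 : Filter.Tendsto (fun x => C * |E x|) l (nhds (C * |E c|)) :=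
      ((hE.abs.tendsto c).mono_left hl).const_mul C
    have h3 : |G c| ≤ C * |E c| := le_of_tendsto_of_tendsto h1 h2 <| by
      filter_upwards [h] with x hx
      rw [hGF k hx.1, abs_mul]
      exact mul_le_mul_of_nonneg_right hx.2 (abs_nonneg _)
    rw [hEG.1, abs_zero, mul_zero] at h3
    exact hEG.2 (abs_nonpos_iff.1 h3)
  have hzero (k : ℕ) : ∃ x ∈ Set.Ioo (j k) (j (k + 1)), F x = 0 := by
    have hlt : j k < j (k + 1) := hj.1 k.lt_succ_self
    obtain ⟨c, hc⟩ : (Set.Ioo (j k) (j (k + 1))).Nonempty := Set.nonempty_Ioo.2 hlt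
    obtain ⟨x, hx, hx0⟩ : ∃ x ∈ Set.Ioo (j k) (j (k + 1)), F x < 0 := by
      by_contra! hcon
      refine hend k (j k) (F c) (Or.inl rfl) (nhdsWithin (j k) (Set.Ioi (j k)))
        nhdsWithin_le_nhds ?_
      filter_upwards [Ioo_mem_nhdsGT hc.1] with x hx
      have hx' : x ∈ Set.Ioo (j k) (j (k + 1)) := ⟨hx.1, hx.2.trans hc.2⟩
      rw [abs_of_nonneg (hcon x hx')]
      exact ⟨hx', (hmono k hx' hc hx.2).le⟩
    obtain ⟨y, hy, hy0⟩ : ∃ y ∈ Set.Ioo (j k) (j (k + 1)), 0 < F y := by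
      by_contra! hcon
      refine hend k (j (k + 1)) (-F c) (Or.inr rfl) (nhdsWithin (j (k + 1)) (Set.Iio (j (k + 1))))
        nhdsWithin_le_nhds ?_
      filter_upwards [Ioo_mem_nhdsLT hc.2] with x hx
      have hx' : x ∈ Set.Ioo (j k) (j (k + 1)) := ⟨hc.1.trans hx.1, hx.2⟩
      rw [abs_of_nonpos (hcon x hx')]
      exact ⟨hx', neg_le_neg (hmono k hc hx' hx.1).le⟩
    exact (isPreconnected_Ioo.intermediate_value hx hy (hcont k)) ⟨hx0.le, hy0.le⟩
  choose ω hω hω0 using hzero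
  refine ⟨j, ω, hj, ⟨?_, ?_⟩, (hjS 0).1, hω⟩
  · exact strictMono_nat_of_lt_succ fun k => (hω k).2.trans (hω (k + 1)).1
  · refine Set.Subset.antisymm (Set.range_subset_iff.2 fun k =>
      ⟨(hjS k).1.trans (hω k).1, (hF0 k (hω k)).1 (hω0 k)⟩) fun z hz => ?_
    have hzS (k : ℕ) : j k ≠ z := by rintro rfl; exact (hjS k).2.2 hz.2
    -- F increases strictly from F 0 = 0, so it has no zero in (0, j 0).
    have h0 : j 0 < z := by
      by_contra! hle
      have hlt := lt_of_le_of_ne hle (hzS 0).symm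
      have := hmono0 ⟨le_rfl, (hjS 0).1⟩ ⟨hz.1.le, hlt⟩ hz.1
      simp [hFdef, hG0, hz.2] at this
    have hex : ∃ k, z < j k := by
      by_contra! hcon
      exact Set.infinite_range_of_injective hj.1.injective
        ((hfin z).subset (Set.range_subset_iff.2 fun k => ⟨hjS k, hcon k⟩))
    classical
    obtain ⟨k, hk⟩ : ∃ k, Nat.find hex = k + 1 := by
      refine Nat.exists_eq_succ_of_ne_zero fun h => ?_
      have := Nat.find_spec hex
      rw [h] at this
      exact lt_asymm this h0
    have hz1 : z < j (k + 1) := hk ▸ Nat.find_spec hex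
    have hz2 : j k < z := lt_of_le_of_ne (not_lt.1 (Nat.find_min hex (by omega))) (hzS k)
    refine ⟨k, (hmono k).injOn (hω k) ⟨hz2, hz1⟩ ?_⟩
    rw [hω0, (hF0 k ⟨hz2, hz1⟩).2 hz.2]

/-! ### Monotonicity of the quotient -/

theorem hasDerivAt_sq_div_four (x : ℝ) : HasDerivAt (fun y : ℝ => y ^ 2 / 4) (x / 2) x := by
  refine ((hasDerivAt_pow 2 x).div_const 4).congr_deriv ?_
  push_cast
  ring

/-- Handles the removable singularities. The convention 0 / 0 = 0 assigns the quotient its limit at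
x, and its slope is t times the slopes of u and p over that of w. -/
theorem hasDerivAt_mul_mul_div_of_eq_zero {t u p w : ℝ → ℝ} {u' p' w' x : ℝ}
    (ht : ContinuousAt t x) (hu : HasDerivAt u u' x) (hp : HasDerivAt p p' x)
    (hw : HasDerivAt w w' x) (hu0 : u x = 0) (hp0 : p x = 0) (hw0 : w x = 0) (hw' : w' ≠ 0) :
    HasDerivAt (fun y => t y * (u y * p y) / w y) (t x * (u' * p') / w') x := by
  rw [hasDerivAt_iff_tendsto_slope] at hu hp hw ⊢
  have := ((ht.tendsto.mono_left nhdsWithin_le_nhds).mul (hu.mul hp)).div hw hw'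
  refine this.congr' ?_
  filter_upwards [self_mem_nhdsWithin] with y hy
  have hyx : y - x ≠ 0 := sub_ne_zero.2 hy
  simp only [Pi.div_apply, slope_def_field, hu0, hp0, hw0, sub_zero, div_zero]
  rcases eq_or_ne (w y) 0 with h | h
  · simp [h]
  · field_simp

theorem besselE_succ_ne_zero_of_eq_zero {ν s : ℝ} (hν : -1 < ν) (hs : 0 < s)
    (h : besselE ν s = 0) : besselE (ν + 1) s ≠ 0 := by
  intro h'
  have := besselE_wronskian_pos hν hs
  simp [h, h'] at this

/-- At such s the recurrence reads Q_{n+1} E_{ν+n+1} = s Q_n E_{ν+n+2}; neither consecutive Q's nor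
consecutive E's share a positive zero. -/
theorem eval_lommelQ_eq_zero_iff_of_besselE_eq_zero {ν s : ℝ} (hν : -1 < ν) (hs : 0 < s) (n : ℕ)
    (h : besselE ν s = 0) : (lommelQ ν n).eval s = 0 ↔ besselE (ν + n + 1) s = 0 := by
  have hn : (0 : ℝ) ≤ n := n.cast_nonneg
  have e := besselE_eq_lommelQ hν s n
  rw [h] at e
  constructor <;> intro h0
  · have hq := lommelQ_wronskian_pos hν hs n
    simp only [h0, mul_zero, zero_mul, zero_add, sub_zero] at hq e
    have : (lommelQ ν (n + 1)).eval s ≠ 0 := by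
      intro h1
      simp [h1] at hq
    exact (mul_eq_zero.1 e.symm).resolve_left this
  · have hb := besselE_succ_ne_zero_of_eq_zero (ν := ν + n + 1) (by linarith) hs h0
    rw [show ν + n + 1 + 1 = ν + n + 2 by ring] at hb
    rw [h0, mul_zero, zero_sub, zero_eq_neg] at e
    simpa [hb, hs.ne'] using e

/-- The function `J_{ν+n+1} R_{n,ν+1} / J_ν` has positive derivative on `(0, ∞)` away from its
poles, removable singularities included. -/
theorem exists_hasDerivAt_besselE_mul_lommelQ_div {ν x : ℝ} (hν : -1 < ν) (hx : 0 < x) (n : ℕ)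
    (h : besselE ν (x ^ 2 / 4) ≠ 0 ∨
      x / 2 * (besselE (ν + n + 1) (x ^ 2 / 4) * (lommelQ ν n).eval (x ^ 2 / 4)) = 0) :
    ∃ d, 0 < d ∧ HasDerivAt (fun y => y / 2 * (besselE (ν + n + 1) (y ^ 2 / 4) *
      (lommelQ ν n).eval (y ^ 2 / 4)) / besselE ν (y ^ 2 / 4)) d x := by
  have hn : (0 : ℝ) ≤ n := n.cast_nonneg
  have hs : 0 < x ^ 2 / 4 := by positivity
  have dq := hasDerivAt_sq_div_four x
  have du := (hasDerivAt_besselE (ν := ν + n + 1) (by linarith) (x ^ 2 / 4)).comp x dq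
  have dp := ((lommelQ ν n).hasDerivAt (x ^ 2 / 4)).comp x dq
  have dw := (hasDerivAt_besselE hν (x ^ 2 / 4)).comp x dq
  have dx : HasDerivAt (fun y : ℝ => y / 2) (1 / 2) x := (hasDerivAt_id x).div_const 2
  have hA := lommelQ_wronskian_pos hν hs n
  have hT := besselE_wronskian_pos (μ := ν + n + 1) (by linarith) hs
  have e : ∀ s, besselE ν s = (lommelQ ν (n + 1)).eval s * besselE (ν + n + 1) s
      - s * (lommelQ ν n).eval s * besselE (ν + n + 2) s := fun s => besselE_eq_lommelQ hν s n
  have db := hasDerivAt_besselE (ν := ν + n + 2) (by linarith) (x ^ 2 / 4)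
  have hw' : -besselE (ν + 1) (x ^ 2 / 4) =
      (lommelQ ν (n + 1)).derivative.eval (x ^ 2 / 4) * besselE (ν + n + 1) (x ^ 2 / 4) -
      (lommelQ ν (n + 1)).eval (x ^ 2 / 4) * besselE (ν + n + 2) (x ^ 2 / 4) -
      ((lommelQ ν n).eval (x ^ 2 / 4) +
        x ^ 2 / 4 * (lommelQ ν n).derivative.eval (x ^ 2 / 4)) * besselE (ν + n + 2) (x ^ 2 / 4) +
      x ^ 2 / 4 * (lommelQ ν n).eval (x ^ 2 / 4) * besselE (ν + n + 3) (x ^ 2 / 4) := by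
    have da := hasDerivAt_besselE (ν := ν + n + 1) (by linarith) (x ^ 2 / 4)
    rw [show ν + n + 1 + 1 = ν + n + 2 by ring] at da
    rw [show ν + n + 2 + 1 = ν + n + 3 by ring] at db
    have d := (((lommelQ ν (n + 1)).hasDerivAt (x ^ 2 / 4)).mul da).sub
      (((hasDerivAt_id (x ^ 2 / 4)).mul ((lommelQ ν n).hasDerivAt (x ^ 2 / 4))).mul db)
    refine (hasDerivAt_besselE hν (x ^ 2 / 4)).unique
      ((d.congr_of_eventuallyEq (Filter.Eventually.of_forall e)).congr_deriv ?_)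
    simp only [Pi.mul_apply, id]
    ring
  have r := besselE_recurrence (ν := ν + n + 1) (by linarith) (x ^ 2 / 4)
  have es := e (x ^ 2 / 4)
  rw [show ν + n + 1 + 1 = ν + n + 2 by ring] at du hT r
  rw [show ν + n + 1 + 2 = ν + n + 3 by ring] at r
  by_cases hw : besselE ν (x ^ 2 / 4) = 0
  · have hup := (mul_eq_zero.1 (h.resolve_left (not_not.2 hw))).resolve_left (by positivity)
    have hiff := eval_lommelQ_eq_zero_iff_of_besselE_eq_zero hν hs n hw
    have hu0 : besselE (ν + n + 1) (x ^ 2 / 4) = 0 := by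
      rcases mul_eq_zero.1 hup with h | h
      exacts [h, hiff.1 h]
    have hp0 := hiff.2 hu0
    refine ⟨_, ?_, hasDerivAt_mul_mul_div_of_eq_zero dx.continuousAt du dp dw hu0 hp0 hw
      (mul_ne_zero (neg_ne_zero.2 (besselE_succ_ne_zero_of_eq_zero hν hs hw)) (by positivity))⟩
    rw [hw']
    simp only [hu0, hp0, mul_zero, zero_mul, zero_add, zero_sub, sub_zero, add_zero,
      ne_eq, OfNat.ofNat_ne_zero, not_false_eq_true, zero_pow] at hA hT ⊢
    set b := besselE (ν + n + 2) (x ^ 2 / 4)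
    set p' := (lommelQ ν n).derivative.eval (x ^ 2 / 4)
    set P := (lommelQ ν (n + 1)).eval (x ^ 2 / 4)
    have hb : b ≠ 0 := by
      rintro h0
      simp [h0] at hT
    have hPp : 0 < P * p' := by
      have := pos_of_mul_pos_right hA hs.le
      rwa [mul_comm]
    have hP : P ≠ 0 := left_ne_zero_of_mul hPp.ne'
    have hd : P * (P + x ^ 2 / 4 * p') ≠ 0 := by
      have : 0 < P * P + x ^ 2 / 4 * (P * p') :=
        add_pos_of_nonneg_of_pos (mul_self_nonneg P) (mul_pos hs hPp)
      exact fun h => this.ne' (by linear_combination h)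
    have hd' := right_ne_zero_of_mul hd
    -- The derivative is s p' / (P + s p') with s = x ^ 2 / 4; expanding by P makes numerator and
    -- denominator visibly positive.
    have : 0 < x ^ 2 / 4 * (P * p') / (P * P + x ^ 2 / 4 * (P * p')) :=
      div_pos (mul_pos hs hPp) (add_pos_of_nonneg_of_pos (mul_self_nonneg P) (mul_pos hs hPp))
    refine this.trans_eq ?_
    have e1 : P * P + x ^ 2 / 4 * (P * p') = P * (P + x ^ 2 / 4 * p') := by ring
    have e2 : -(P * b) - x ^ 2 / 4 * p' * b = -b * (P + x ^ 2 / 4 * p') := by ring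
    rw [e1, e2]
    have hx' := hx.ne'
    generalize P + x ^ 2 / 4 * p' = K at hd'
    field_simp
    ring
  · refine ⟨_, ?_, (dx.mul (du.mul dp)).div dw hw⟩
    simp only [Function.comp_apply, Pi.mul_apply]
    refine div_pos ?_ (by positivity)
    rw [hw', es]
    have hpos : besselE (ν + n + 1) (x ^ 2 / 4) ≠ 0 ∨ (lommelQ ν n).eval (x ^ 2 / 4) ≠ 0 := by
      by_contra! hcon
      rw [hcon.1, hcon.2] at es
      exact hw (by rw [es]; ring)
    set a := besselE (ν + n + 1) (x ^ 2 / 4)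
    set b := besselE (ν + n + 2) (x ^ 2 / 4)
    set p := (lommelQ ν n).eval (x ^ 2 / 4)
    set p' := (lommelQ ν n).derivative.eval (x ^ 2 / 4)
    set P := (lommelQ ν (n + 1)).eval (x ^ 2 / 4)
    set P' := (lommelQ ν (n + 1)).derivative.eval (x ^ 2 / 4)
    -- The numerator of F' splits into the two Wronskians with weights a ^ 2 and s p ^ 2, not both
    -- zero because E_ν ≠ 0 here.
    have key : 0 < a ^ 2 * (1 / 2 * p * P + x ^ 2 / 4 * (p' * P - p * P')) +
        x ^ 2 / 4 * p ^ 2 *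
          (a ^ 2 + x ^ 2 / 4 * b ^ 2 - (ν + n + 1 + 1 / 2) * (a * b)) := by
      rcases hpos with h | h
      · exact add_pos_of_pos_of_nonneg (mul_pos (by positivity) hA)
          (mul_nonneg (by positivity) hT.le)
      · exact add_pos_of_nonneg_of_pos (mul_nonneg (by positivity) hA.le)
          (mul_pos (by positivity) hT)
    refine key.trans_eq ?_
    linear_combination (x ^ 2 / 4 * p ^ 2 * a) * r

/-! ### Size of the zero sets -/

/-- The zeros are simple, hence isolated, and 0 is not one of them, so those in the compact interval
[0, M] are finitely many. -/
theorem finite_besselE_zeros_inter_Iic {ν : ℝ} (hν : -1 < ν) (M : ℝ) :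
    ({x | 0 < x ∧ besselE ν (x ^ 2 / 4) = 0} ∩ Set.Iic M).Finite := by
  have hc : Continuous fun x : ℝ => besselE ν (x ^ 2 / 4) :=
    (continuous_besselE hν).comp (by fun_prop)
  have hsub : {x | 0 < x ∧ besselE ν (x ^ 2 / 4) = 0} ∩ Set.Iic M ⊆
      Set.Icc 0 M ∩ {x | besselE ν (x ^ 2 / 4) = 0} :=
    fun x hx => ⟨⟨hx.1.1.le, hx.2⟩, hx.1.2⟩
  refine Set.Finite.subset ?_ hsub
  refine (isCompact_Icc.inter_right (isClosed_eq hc continuous_const)).finite ?_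
  refine isDiscrete_iff_nhdsNE.2 fun x hx => ?_
  have hx0 : 0 < x := by
    refine lt_of_le_of_ne hx.1.1 fun h => (besselE_zero_pos hν).ne' ?_
    simpa [← h] using hx.2
  have hd := (hasDerivAt_besselE hν (x ^ 2 / 4)).comp x (hasDerivAt_sq_div_four x)
  have hne := hd.eventually_ne (c := 0) (mul_ne_zero
    (neg_ne_zero.2 (besselE_succ_ne_zero_of_eq_zero hν (by positivity) hx.2)) (by positivity))
  rw [← disjoint_iff, Filter.disjoint_principal_right]
  filter_upwards [hne] with y hy hy'
  exact hy hy'.2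

theorem infinite_besselE_zeros {ν : ℝ} (hν : -1 < ν) :
    {x | 0 < x ∧ besselE ν (x ^ 2 / 4) = 0}.Infinite := by
  intro hfin
  obtain ⟨M, hM⟩ := hfin.bddAbove
  obtain ⟨x, hMx, hx⟩ := exists_besselE_eq_zero_of_gt hν M
  exact hMx.not_ge (hM hx)

theorem finite_lommelQ_zeros {ν : ℝ} (hν : -1 < ν) (n : ℕ) :
    {x : ℝ | 0 < x ∧ (lommelQ ν n).eval (x ^ 2 / 4) = 0}.Finite := by
  refine Set.Finite.of_finite_image (f := fun x : ℝ => x ^ 2 / 4)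
    ((Polynomial.finite_setOfPred_isRoot (lommelQ_ne_zero hν n)).subset ?_) fun x hx y hy hxy => ?_
  · rintro _ ⟨x, hx, rfl⟩
    exact hx.2
  · have hxy' : x ^ 2 / 4 = y ^ 2 / 4 := hxy
    exact (pow_left_inj₀ hx.1.le hy.1.le two_ne_zero).1 (by linarith)

theorem theorem3p2 (ν : ℝ) (hν : -1 < ν) (m : ℕ) (hm : 1 ≤ m) :
    ∃ j ω : ℕ → ℝ,
      IsAscendingList (posZeros (besselJ ν) \ commonZeros m ν) j ∧
      IsAscendingList
        (posZeros (besselJ (ν + m)) ∪ posZeros (lommelR (m - 1) (ν + 1))) ω ∧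
      0 < j 0 ∧ ∀ k : ℕ, j k < ω k ∧ ω k < j (k + 1) := by
  obtain ⟨n, rfl⟩ : ∃ n, m = n + 1 := ⟨m - 1, by omega⟩
  have hn : (0 : ℝ) ≤ n := n.cast_nonneg
  have hνn : ν + ((n + 1 : ℕ) : ℝ) = ν + n + 1 := by push_cast; ring
  set E : ℝ → ℝ := fun y => besselE ν (y ^ 2 / 4) with hE
  set G : ℝ → ℝ := fun y => y / 2 * (besselE (ν + n + 1) (y ^ 2 / 4) *
    (lommelQ ν n).eval (y ^ 2 / 4)) with hG
  have hG0 {x : ℝ} (hx : 0 < x) : G x = 0 ↔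
      besselE (ν + n + 1) (x ^ 2 / 4) = 0 ∨ (lommelQ ν n).eval (x ^ 2 / 4) = 0 := by
    rw [hG, mul_eq_zero, or_iff_right (by positivity), mul_eq_zero]
  have hEG {x : ℝ} (hx : 0 < x) (h : E x = 0) :
      (G x = 0 ↔ besselE (ν + n + 1) (x ^ 2 / 4) = 0) ∧
        (G x = 0 ↔ (lommelQ ν n).eval (x ^ 2 / 4) = 0) := by
    rw [hG0 hx, eval_lommelQ_eq_zero_iff_of_besselE_eq_zero hν (by positivity) n h, or_self]
    exact ⟨Iff.rfl, Iff.rfl⟩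
  have hS : posZeros (besselJ ν) \ commonZeros (n + 1) ν = {x | 0 < x ∧ E x = 0 ∧ G x ≠ 0} := by
    ext x
    simp only [commonZeros, posZeros, Set.mem_sdiff, Set.mem_ofPred_eq, not_and, and_imp, hνn]
    constructor
    · rintro ⟨⟨hx, h1⟩, h2⟩
      have hEx : E x = 0 := (besselJ_eq_zero_iff ν hx).1 h1
      have h3 := h2 hx h1
      rw [besselJ_eq_zero_iff _ hx, ← (hEG hx hEx).1] at h3
      exact ⟨hx, hEx, h3⟩
    · rintro ⟨hx, hEx, hGx⟩
      rw [besselJ_eq_zero_iff _ hx, besselJ_eq_zero_iff _ hx, ← (hEG hx hEx).1]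
      exact ⟨⟨hx, hEx⟩, fun _ _ => hGx⟩
  have hZ : posZeros (besselJ (ν + (n + 1 : ℕ))) ∪ posZeros (lommelR (n + 1 - 1) (ν + 1)) =
      {x | 0 < x ∧ G x = 0} := by
    ext x
    simp only [posZeros, Set.mem_union, Set.mem_ofPred_eq, hνn, Nat.add_sub_cancel, ← and_or_left]
    refine and_congr_right fun hx => ?_
    rw [besselJ_eq_zero_iff _ hx, lommelR_eq_zero_iff hν hx, hG0 hx]
  rw [hS, hZ]
  refine exists_interlacing_zeros ?_ ?_ ?_ ?_ ?_ ?_ ?_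
  · exact (continuous_besselE hν).comp (by fun_prop)
  · exact (by fun_prop : Continuous fun y : ℝ => y / 2).mul
      (((continuous_besselE (ν := ν + n + 1) (by linarith)).comp (by fun_prop)).mul
        ((lommelQ ν n).continuous.comp (by fun_prop)))
  · simpa [hE] using (besselE_zero_pos hν).ne'
  · simp [hG]
  · exact fun x hx h => exists_hasDerivAt_besselE_mul_lommelQ_div hν hx n h
  -- A common zero of E and G is a zero of Q_n, so removing the finite zero set of Q_n suffices.
  · refine ((infinite_besselE_zeros hν).sdiff (finite_lommelQ_zeros hν n)).mono ?_
    rintro x ⟨⟨hx, hEx⟩, h⟩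
    exact ⟨hx, hEx, fun hGx => h ⟨hx, (hEG hx hEx).2.1 hGx⟩⟩
  · exact fun M => (finite_besselE_zeros_inter_Iic hν M).subset
      fun x hx => ⟨⟨hx.1.1, hx.1.2.1⟩, hx.2⟩
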